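/- **Convolutional generators.** Signals live on a periodic $D$-dimensional grid ($D=1$ for vectors, $D=2$ for images). For a signal $z$ on such a grid and a kernel $c$ with $\ell$ taps per direction let $T(c)z$ be the circular convolution $(T(c)z)_p=\sum_q c_q z_{p+q}$. A convolutional generator with $d\ge 1$ layers and $k$ channels maps a fixed input volume $B_0\in\mathbb R^{n_0\times k}$ and parameters $C$ to $$B_{i+1}=\mathrm{relu}\Big(\Big[\sum_{j=1}^k T(c_{isj})U_i b_{ij}\Big]_{s=1,\dots,k}\Big)\quad(0\le i<d),\qquad G(C)=\phi(B_dC_d),$$ where $b_{ij}$ is the $j$-th channel (column) of $B_i$, each $U_i$ is either the identity or upsampling by the factor two in every direction by inserting zeros, $C_d\in\mathbb R^{k\times k_{\rm out}}$, and $\phi$ is the identity or the entrywise sigmoid. In each layer the filters are either fixed up to a learnable scalar, $c_{isj}=\theta_{isj}w_i$ with a fixed kernel $w_i$, or fully learnable. The parameter vector $C\in\mathbb R^N$ collects all $N$ learnable numbers of all filters together with the entries of $C_d$, and $G(C)\in\mathbb R^n$. Let $\kappa\ge 0$ be a number such that in every layer the linear operator "upsample, then convolve" has Euclidean operator norm at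 most $\kappa$: this operator is $z\mapsto T(w_i)U_iz$ for a fixed kernel, and $(z_q)_q\mapsto\sum_q T(e_q)U_iz_q$, with $q$ running over the taps and $e_q$ the unit kernel at $q$, for learnable filters. (For suitably scaled fixed kernels one may take $\kappa=1$; for learnable filters with $L$ taps in total, $\kappa=\sqrt L$.) **Theorem.** There are absolute constants $K,c>0$ such that the following holds for every convolutional generator $G$ as above whose input volume has spectral norm $\|B_0\|\le\xi$. Let $\mu>0$, let $\mathcal B(\mu)=\{C\in\mathbb R^N:\|C\|_2\le\mu\}$, and let $\delta>0$ be a slack parameter which, if $\kappa\mu>1$, satisfies $\kappa\delta\le d\,\xi$. Let $x^*\in\mathbb R^n$ and let $A\in\mathbb R^{m\times n}$ have i.i.d. $\mathcal N(0,1/m)$ entries, where $$m\ \ge\ K\,N\,d\,\log\!\big(d\,\xi\,\mu/\delta\big).$$ Then the minimum of $\|G(C)-x^*\|_2$ over $C\in\mathcal B(\mu)$ is attained, and with probability at least $1-e^{-cm}$ the matrix $A$ has the following property: for every noise vector $\eta\in\mathbb R^m$ with $y=Ax^*+\eta$, every $\epsilon$, and every $\hat C\in\mathcal B(\mu)$ that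 minimizes $\|y-AG(C)\|_2$ over $\mathcal B(\mu)$ to within an additive $\epsilon$ of the optimum, $$\|G(\hat C)-x^*\|_2\ \le\ 6\min_{C^*\in\mathcal B(\mu)}\|G(C^*)-x^*\|_2+3\|\eta\|_2+2\epsilon+2\delta .$$ (For $m=0$ the measurement is empty and the probability bound is trivial. The convention $\log 0=0$ is used if $\xi=0$.) -/

import Mathlib

open MeasureTheory ProbabilityTheory

noncomputable section

namespace ConvNet

/-- The convolution filters of one layer, supported on a `D`-dimensional grid of taps with `ℓ` taps
per direction: either a fixed kernel `w` that is only multiplied by a learnable scalar, or a kernel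
all of whose taps are learnable. -/
inductive FilterKind (D ℓ : ℕ) : Type
  | fixed (w : (Fin D → Fin ℓ) → ℝ) : FilterKind D ℓ
  | learned : FilterKind D ℓ

/-- Index type of the learnable numbers in one filter. -/
def FilterKind.Coeff {D ℓ : ℕ} : FilterKind D ℓ → Type
  | .fixed _ => Unit
  | .learned => Fin D → Fin ℓ

instance FilterKind.fintypeCoeff {D ℓ : ℕ} : (F : FilterKind D ℓ) → Fintype F.Coeff
  | .fixed _ => inferInstanceAs (Fintype Unit)
  | .learned => inferInstanceAs (Fintype (Fin D → Fin ℓ))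

instance FilterKind.decidableEqCoeff {D ℓ : ℕ} : (F : FilterKind D ℓ) → DecidableEq F.Coeff
  | .fixed _ => inferInstanceAs (DecidableEq Unit)
  | .learned => inferInstanceAs (DecidableEq (Fin D → Fin ℓ))

/-- The convolution kernel determined by the learnable numbers `c`. -/
def FilterKind.kernel {D ℓ : ℕ} :
    (F : FilterKind D ℓ) → (F.Coeff → ℝ) → (Fin D → Fin ℓ) → ℝ
  | .fixed w, c => fun q => c () * w q
  | .learned, c => c

/-- The pixels of a `D`-dimensional grid with `s a` pixels in direction `a`. -/
abbrev Pixels {D : ℕ} (s : Fin D → ℕ) : Type := (a : Fin D) → Fin (s a)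

/-- Upsampling by the factor `f` in every direction by inserting zeros; for `f = 1` this is the
identity. -/
def upsample {D : ℕ} {s : Fin D → ℕ} (f : ℕ) (x : Pixels s → ℝ) :
    Pixels (fun a => f * s a) → ℝ :=
  fun p => if ∀ a, f ∣ (p a : ℕ) then
    x (fun a => ⟨(p a : ℕ) / f, Nat.div_lt_of_lt_mul (p a).isLt⟩) else 0

/-- Circular convolution with the kernel `c`, given in one dimension by the circulant matrix with
first row `(c₁, …, c_ℓ, 0, …, 0)`. -/
def conv {D ℓ : ℕ} {s : Fin D → ℕ} (c : (Fin D → Fin ℓ) → ℝ) (z : Pixels s → ℝ) :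
    Pixels s → ℝ :=
  fun p => ∑ q : Fin D → Fin ℓ, c q *
    z (fun a => ⟨((p a : ℕ) + (q a : ℕ)) % s a, Nat.mod_lt _ (Nat.zero_lt_of_lt (p a).isLt)⟩)

/-- The map applied entrywise to the last linear combination of the channels. -/
inductive OutputMap : Type
  | identity : OutputMap
  | sigmoid : OutputMap

def OutputMap.apply : OutputMap → ℝ → ℝ
  | .identity, t => t
  | .sigmoid, t => Real.sigmoid t

/-- A convolutional generator: `depth` convolutional ReLU layers with `channels` channels, acting on
a fixed input volume, followed by a linear combination of the channels. The spatial dimension `dim`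
is `1` for signals and `2` for images. Only the values of `up` and `filter` at layers `i < depth`
matter. -/
structure ConvGenerator : Type where
  dim : ℕ
  depth : ℕ
  channels : ℕ
  outChannels : ℕ
  taps : ℕ
  inputSize : Fin dim → ℕ
  input : Matrix (Pixels inputSize) (Fin channels) ℝ
  up : ℕ → Bool
  filter : ℕ → FilterKind dim taps
  output : OutputMap

namespace ConvGenerator

/-- The upsampling factor of layer `i`. -/
def factor (G : ConvGenerator) (i : ℕ) : ℕ := if G.up i then 2 else 1

/-- The spatial size of the volume `B i`. -/
def size (G : ConvGenerator) : ℕ → Fin G.dim → ℕ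
  | 0 => G.inputSize
  | i + 1 => fun a => G.factor i * size G i a

/-- Index type of all learnable parameters. The entry `(i, c, s, j)` is the learnable number `c` of
the filter in layer `i` from the input channel `j` to the output channel `s`; the remaining entries
are the weights of the final linear combinations. -/
abbrev ParamIndex (G : ConvGenerator) : Type :=
  (Σ i : Fin G.depth, (G.filter i).Coeff × Fin G.channels × Fin G.channels) ⊕
    (Fin G.channels × Fin G.outChannels)

/-- The parameter space, with the Euclidean norm. -/
abbrev Params (G : ConvGenerator) : Type := EuclideanSpace ℝ G.ParamIndex

/-- The number of parameters. -/
def numParams (G : ConvGenerator) : ℕ := Fintype.card G.ParamIndex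

/-- Index type of the entries of the generated signal. -/
abbrev OutIndex (G : ConvGenerator) : Type := Pixels (G.size G.depth) × Fin G.outChannels

/-- The signal space, with the Euclidean norm. -/
abbrev Signal (G : ConvGenerator) : Type := EuclideanSpace ℝ G.OutIndex

/-- Layer `i`: output channel `s` is the ReLU of the sum, over the input channels `j`, of the
upsampled channel `j` convolved with the filter `(s, j)`. -/
def layer (G : ConvGenerator) (i : ℕ)
    (θ : (G.filter i).Coeff × Fin G.channels × Fin G.channels → ℝ)
    (B : Matrix (Pixels (G.size i)) (Fin G.channels) ℝ) :
    Matrix (Pixels (G.size (i + 1))) (Fin G.channels) ℝ :=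
  Matrix.of fun p s => max 0 (∑ j : Fin G.channels,
    conv ((G.filter i).kernel fun c => θ (c, s, j)) (upsample (G.factor i) fun p' => B p' j) p)

/-- The volume after `i` layers. -/
def volume (G : ConvGenerator) (C : G.Params) :
    (i : ℕ) → i ≤ G.depth → Matrix (Pixels (G.size i)) (Fin G.channels) ℝ
  | 0, _ => G.input
  | i + 1, h => G.layer i (fun t => C (Sum.inl ⟨⟨i, h⟩, t⟩))
      (volume G C i (Nat.le_of_succ_le h))

/-- The generated signal. -/
def generate (G : ConvGenerator) (C : G.Params) : G.Signal :=
  WithLp.toLp 2 fun t => G.output.apply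
    (∑ j : Fin G.channels, G.volume C G.depth le_rfl t.1 j * C (Sum.inr (j, t.2)))

open scoped Matrix.Norms.L2Operator in
/-- The spectral norm of the input volume. -/
def inputNorm (G : ConvGenerator) : ℝ := ‖G.input‖

/-- The linear operator of upsampling followed by convolution in layer `i` has Euclidean operator
norm at most `κ`. For a fixed kernel `w` the operator is `z ↦ conv w (upsample z)`; for learned
filters it maps a family `z`, indexed by the taps, to the sum of the upsampled and accordingly
shifted signals `z c`, so that its norm is at most the square root of the number of taps. -/
def LayerNormLE (G : ConvGenerator) (i : ℕ) (κ : ℝ) : Prop :=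
  ∀ z : (G.filter i).Coeff → EuclideanSpace ℝ (Pixels (G.size i)),
    ‖(WithLp.toLp 2 (fun p => ∑ c, conv ((G.filter i).kernel (Pi.single c 1))
        (upsample (G.factor i) (z c)) p) : EuclideanSpace ℝ (Pixels (G.size (i + 1))))‖
      ≤ κ * √(∑ c, ‖z c‖ ^ 2)

end ConvGenerator

/-- The law of the entries of a random matrix with `m` rows and independent `N(0, 1/m)` entries. -/
def gaussianMatrix (m : ℕ) (ι : Type) [Fintype ι] : Measure (Fin m → ι → ℝ) :=
  Measure.pi fun _ : Fin m => Measure.pi fun _ : ι => gaussianReal 0 (1 / (m : NNReal))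

end ConvNet

end

open MeasureTheory ProbabilityTheory

noncomputable section

namespace ConvNet

/-! The generator is Lipschitz on the parameter ball, and a Gaussian matrix behaves well on the
Lipschitz image of a low-dimensional ball. The best approximation `z` is fixed before `A` is drawn,
so `A` needs an upper bound on the single vector `G z - x` and a lower bound on the differences `G C
- G z`; the triangle inequality does the rest (`recovery_of_restricted_eigenvalue`).

The lower bound holds by a union bound on a net of radius `r`, and is extended to every `C` by
chaining through nets of radius `r / 2 ^ i` (`exists_event_restricted_eigenvalue`). At level `i` a
stretch of `2 * (i + 1)` is allowed: its failure exponent is quadratic in `i + 1`, whereas the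
logarithm of the number of pairs is linear, and the resulting series of increments still converges.
No operator norm of `A` enters, hence no ambient dimension.

With `R = d * ξ * μ / δ` and `b = max (κ * μ) 1`, the Lipschitz constant is at most `(d + 1) * ξ * b
^ d` (`norm_generate_sub_le`). The slack condition gives `b ≤ R` once `R > √2`, so the
log-cardinality of the nets is of order `N * d * log R`, up to a factor linear in the level
(`net_card_le`).

If `R ≤ √2`, the hypothesis on `m` may be void. Then AM-GM on the layerwise parameter norms shows
that the image of the whole ball has diameter at most `2 * δ`, and every `A` works
(`norm_generate_sub_le_of_ratio_le`). -/

section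

/-! ### Chernoff bounds for a Gaussian matrix applied to one vector. -/

/-- A linear combination of independent centred Gaussians of equal variance is Gaussian. -/
lemma map_sum_mul_pi_gaussianReal {ι : Type*} [Fintype ι] (w : NNReal) (v : ι → ℝ) :
    (Measure.pi fun _ : ι => gaussianReal 0 w).map (fun a => ∑ j, a j * v j)
      = gaussianReal 0 (w * ∑ j, ‖v j‖₊ ^ 2) := by
  have hmeas : Measurable fun a : ι → ℝ => ∑ j, a j * v j := by fun_prop
  have := Measure.isProbabilityMeasure_map (μ := Measure.pi fun _ : ι => gaussianReal 0 w)
    hmeas.aemeasurable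
  -- Independence turns the characteristic function of the sum into a product of Gaussian ones.
  apply Measure.ext_of_charFun
  ext t
  rw [charFun_gaussianReal, charFun_apply_real, integral_map hmeas.aemeasurable (by fun_prop)]
  have h1 : ∀ a : ι → ℝ, Complex.exp (t * ((∑ j, a j * v j : ℝ) : ℂ) * Complex.I)
      = ∏ j, Complex.exp (((t * v j : ℝ) : ℂ) * (a j : ℂ) * Complex.I) := by
    intro a
    rw [← Complex.exp_sum]
    congr 1
    push_cast
    rw [Finset.mul_sum, Finset.sum_mul]
    exact Finset.sum_congr rfl fun j _ => by ring
  simp_rw [h1]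
  rw [integral_fintype_prod_eq_prod
    (f := fun j (x : ℝ) => Complex.exp (((t * v j : ℝ) : ℂ) * (x : ℂ) * Complex.I))]
  simp_rw [← charFun_apply_real, charFun_gaussianReal]
  rw [← Complex.exp_sum]
  congr 1
  have h2 : (((w * ∑ j, ‖v j‖₊ ^ 2 : NNReal) : ℝ) : ℂ) = w * ∑ j, (v j : ℂ) ^ 2 := by
    push_cast
    congr 1
    refine Finset.sum_congr rfl fun j _ => ?_
    rw [← Complex.ofReal_pow, Real.norm_eq_abs, sq_abs, Complex.ofReal_pow]
  simp only [Complex.ofReal_zero, mul_zero, zero_mul, zero_sub]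
  rw [Finset.sum_neg_distrib, ← Finset.sum_div]
  erw [h2]
  congr 2
  rw [Finset.mul_sum, Finset.sum_mul]
  exact Finset.sum_congr rfl fun j _ => by push_cast; ring

/-- The exponential moments of the square of a centred Gaussian. -/
lemma integral_exp_mul_sq_gaussianReal {w : NNReal} (hw : w ≠ 0) {t : ℝ} (ht : 2 * t * w < 1) :
    ∫ x, Real.exp (t * x ^ 2) ∂(gaussianReal 0 w) = (√(1 - 2 * t * w))⁻¹ := by
  have hw' : (0 : ℝ) < w := by positivity
  rw [integral_gaussianReal_eq_integral_smul hw]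
  have h1 : ∀ x : ℝ, gaussianPDFReal 0 w x • Real.exp (t * x ^ 2)
      = (√(2 * Real.pi * w))⁻¹ * Real.exp (-(1 / (2 * w) - t) * x ^ 2) := by
    intro x
    rw [gaussianPDFReal, smul_eq_mul, mul_assoc, ← Real.exp_add]
    congr 2
    field_simp
    ring
  simp_rw [h1]
  rw [integral_const_mul, integral_gaussian, ← Real.sqrt_inv, ← Real.sqrt_mul (by positivity),
    ← Real.sqrt_inv]
  congr 1
  have : (1 : ℝ) - 2 * t * w ≠ 0 := by linarith
  have h3 : (1 : ℝ) / (2 * w) - t = (1 - 2 * t * w) / (2 * w) := by field_simp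
  rw [h3]
  field_simp

lemma integrable_exp_mul_sq_gaussianReal {w : NNReal} (hw : w ≠ 0) {t : ℝ} (ht : 2 * t * w < 1) :
    Integrable (fun x => Real.exp (t * x ^ 2)) (gaussianReal 0 w) := by
  -- A non-integrable function has integral zero by convention, but the formula above gives a
  -- positive value.
  by_contra h
  have h1 := integral_exp_mul_sq_gaussianReal hw ht
  rw [integral_undef h] at h1
  have : 0 < (√(1 - 2 * t * w))⁻¹ := inv_pos.2 (Real.sqrt_pos.2 (by linarith))
  linarith

instance (m : ℕ) (ι : Type) [Fintype ι] : IsProbabilityMeasure (gaussianMatrix m ι) := by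
  unfold gaussianMatrix; infer_instance

variable {ι : Type} [Fintype ι] [DecidableEq ι] {m : ℕ}

lemma norm_sq_toEuclideanLin (A : Fin m → ι → ℝ) (v : EuclideanSpace ℝ ι) :
    ‖Matrix.toEuclideanLin (Matrix.of A) v‖ ^ 2 = ∑ i, (∑ j, A i j * v j) ^ 2 := by
  rw [EuclideanSpace.real_norm_sq_eq]
  simp [Matrix.toLpLin_apply, Matrix.mulVec, dotProduct]

/-- The exponential moments of the squared norm of the image of a fixed vector under a Gaussian
matrix. -/
lemma mgf_norm_sq_gaussianMatrix (hm : m ≠ 0) {v : EuclideanSpace ℝ ι} (hv : v ≠ 0) {b : ℝ}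
    (hb : b < 1 / 2) :
    Integrable (fun A => Real.exp (b * m / ‖v‖ ^ 2 *
        ‖Matrix.toEuclideanLin (Matrix.of A) v‖ ^ 2)) (gaussianMatrix m ι) ∧
      mgf (fun A => ‖Matrix.toEuclideanLin (Matrix.of A) v‖ ^ 2) (gaussianMatrix m ι)
        (b * m / ‖v‖ ^ 2) = (√(1 - 2 * b))⁻¹ ^ m := by
  set t : ℝ := b * m / ‖v‖ ^ 2
  have hm' : (m : ℝ) ≠ 0 := by exact_mod_cast hm
  have hv' : ‖v‖ ^ 2 ≠ 0 := by positivity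
  set w : NNReal := 1 / (m : NNReal) * ∑ j, ‖v j‖₊ ^ 2
  have hw : (w : ℝ) = ‖v‖ ^ 2 / m := by
    simp only [w]
    rw [EuclideanSpace.real_norm_sq_eq]
    push_cast
    simp only [Real.norm_eq_abs, sq_abs]
    ring
  have hw0 : w ≠ 0 := by
    intro h
    rw [h] at hw
    have : ‖v‖ ^ 2 / m ≠ 0 := div_ne_zero hv' hm'
    exact this hw.symm
  have htw : 2 * t * w = 2 * b := by
    rw [hw]; simp only [t]; field_simp
  have hmeas : Measurable fun a : ι → ℝ => ∑ j, a j * v j := by fun_prop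
  have hmap := map_sum_mul_pi_gaussianReal (1 / (m : NNReal)) (v : ι → ℝ)
  have hint : Integrable (fun a : ι → ℝ => Real.exp (t * (∑ j, a j * v j) ^ 2))
      (Measure.pi fun _ : ι => gaussianReal 0 (1 / (m : NNReal))) := by
    have := integrable_exp_mul_sq_gaussianReal hw0 (t := t) (by rw [htw]; linarith)
    rw [← hmap] at this
    exact this.comp_measurable hmeas
  have hval : ∫ a : ι → ℝ, Real.exp (t * (∑ j, a j * v j) ^ 2)
      ∂(Measure.pi fun _ : ι => gaussianReal 0 (1 / (m : NNReal))) = (√(1 - 2 * b))⁻¹ := by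
    have := integral_exp_mul_sq_gaussianReal hw0 (t := t) (by rw [htw]; linarith)
    rw [← hmap, integral_map hmeas.aemeasurable (by fun_prop), htw] at this
    exact this
  have h1 : ∀ A : Fin m → ι → ℝ,
      Real.exp (t * ‖Matrix.toEuclideanLin (Matrix.of A) v‖ ^ 2)
        = ∏ i, Real.exp (t * (∑ j, A i j * v j) ^ 2) := by
    intro A
    rw [norm_sq_toEuclideanLin, Finset.mul_sum, Real.exp_sum]
  refine ⟨?_, ?_⟩
  · simp_rw [h1]
    exact Integrable.fintype_prod fun _ => hint
  · rw [mgf]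
    simp_rw [h1]
    rw [gaussianMatrix, integral_fintype_prod_eq_pow
      (f := fun a : ι → ℝ => Real.exp (t * (∑ j, a j * v j) ^ 2)), hval, Fintype.card_fin]

/-- A Gaussian matrix stretches a fixed vector by a factor of more than `s ≥ 2` only with
exponentially small probability. -/
lemma gaussianMatrix_upper_tail (hm : m ≠ 0) (v : EuclideanSpace ℝ ι) {s : ℝ} (hs : 2 ≤ s) :
    gaussianMatrix m ι {A | s * ‖v‖ < ‖Matrix.toEuclideanLin (Matrix.of A) v‖}
      ≤ ENNReal.ofReal (Real.exp (-(1 / 8) * s ^ 2 * m)) := by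
  rcases eq_or_ne v 0 with rfl | hv
  · simp
  -- With `b = 1 / 4` the moment is `√2 ^ m ≤ exp (m / 2)`, which costs half of the Chernoff
  -- exponent `s ^ 2 * m / 4` because `s ≥ 2`.
  obtain ⟨hint, hmgf⟩ := mgf_norm_sq_gaussianMatrix hm hv (b := 1 / 4) (by norm_num)
  have hv' : 0 < ‖v‖ := norm_pos_iff.2 hv
  have hch := measure_ge_le_exp_mul_mgf (s ^ 2 * ‖v‖ ^ 2) (by positivity) hint
  rw [hmgf] at hch
  have hsub : {A : Fin m → ι → ℝ | s * ‖v‖ < ‖Matrix.toEuclideanLin (Matrix.of A) v‖}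
      ⊆ {A | s ^ 2 * ‖v‖ ^ 2 ≤ ‖Matrix.toEuclideanLin (Matrix.of A) v‖ ^ 2} := by
    intro A hA
    simp only [Set.mem_ofPred_eq] at hA ⊢
    rw [← mul_pow]
    gcongr
  refine (measure_mono hsub).trans ?_
  rw [← ofReal_measureReal]
  refine ENNReal.ofReal_le_ofReal (hch.trans ?_)
  have h2 : (√(1 - 2 * (1 / 4 : ℝ)))⁻¹ ≤ Real.exp (1 / 2) := by
    rw [← Real.sqrt_inv, Real.sqrt_le_left (by positivity), ← Real.exp_nat_mul]
    have := Real.add_one_le_exp (1 : ℝ)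
    norm_num at this ⊢
    exact this
  calc Real.exp (-(1 / 4 * m / ‖v‖ ^ 2) * (s ^ 2 * ‖v‖ ^ 2)) * (√(1 - 2 * (1 / 4 : ℝ)))⁻¹ ^ m
      ≤ Real.exp (-(1 / 4 * m / ‖v‖ ^ 2) * (s ^ 2 * ‖v‖ ^ 2)) * Real.exp (1 / 2) ^ m := by
        gcongr
    _ = Real.exp (-(1 / 4) * s ^ 2 * m + m * (1 / 2)) := by
        rw [← Real.exp_nat_mul, ← Real.exp_add]
        congr 1
        field_simp
    _ ≤ Real.exp (-(1 / 8) * s ^ 2 * m) := by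
        apply Real.exp_le_exp.2
        have hs2 : 4 ≤ s ^ 2 := by nlinarith
        have : (0 : ℝ) ≤ m := by positivity
        nlinarith

/-- A Gaussian matrix shrinks a fixed vector by a factor of less than `4 / 5` only with
exponentially small probability. -/
lemma gaussianMatrix_lower_tail (hm : m ≠ 0) (v : EuclideanSpace ℝ ι) :
    gaussianMatrix m ι {A | ‖Matrix.toEuclideanLin (Matrix.of A) v‖ < 4 / 5 * ‖v‖}
      ≤ ENNReal.ofReal (Real.exp (-(1 / 50) * m)) := by
  rcases eq_or_ne v 0 with rfl | hv
  · simp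
  obtain ⟨hint, hmgf⟩ := mgf_norm_sq_gaussianMatrix hm hv (b := -1 / 4) (by norm_num)
  have hv' : 0 < ‖v‖ := norm_pos_iff.2 hv
  have hch := measure_le_le_exp_mul_mgf ((4 / 5) ^ 2 * ‖v‖ ^ 2)
    (by rw [neg_div, neg_mul, neg_div]; exact neg_nonpos.2 (by positivity)) hint
  rw [hmgf] at hch
  have hsub : {A : Fin m → ι → ℝ | ‖Matrix.toEuclideanLin (Matrix.of A) v‖ < 4 / 5 * ‖v‖}
      ⊆ {A | ‖Matrix.toEuclideanLin (Matrix.of A) v‖ ^ 2 ≤ (4 / 5) ^ 2 * ‖v‖ ^ 2} := by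
    intro A hA
    simp only [Set.mem_ofPred_eq] at hA ⊢
    rw [← mul_pow]
    gcongr
  refine (measure_mono hsub).trans ?_
  rw [← ofReal_measureReal]
  refine ENNReal.ofReal_le_ofReal (hch.trans ?_)
  -- This amounts to `exp (9 / 25) ≤ 3 / 2`, taken from the Taylor bound. The Chernoff factor
  -- contributes `4 / 25` per row, leaving `9 / 50 - 4 / 25 = 1 / 50`.
  have h2 : (√(1 - 2 * (-1 / 4 : ℝ)))⁻¹ ≤ Real.exp (-(9 / 50)) := by
    rw [← Real.sqrt_inv, Real.sqrt_le_left (by positivity), ← Real.exp_nat_mul, ← inv_inv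
      (Real.exp _), ← Real.exp_neg]
    have h := Real.exp_bound' (x := 9 / 25) (by norm_num) (by norm_num) (n := 3) (by norm_num)
    simp only [Finset.sum_range_succ, Finset.sum_range_zero] at h
    norm_num [Nat.factorial] at h ⊢
    rw [show (2 / 3 : ℝ) = (3 / 2)⁻¹ by norm_num]
    apply inv_anti₀ (Real.exp_pos _)
    linarith
  calc Real.exp (-(-1 / 4 * m / ‖v‖ ^ 2) * ((4 / 5) ^ 2 * ‖v‖ ^ 2))
        * (√(1 - 2 * (-1 / 4 : ℝ)))⁻¹ ^ m
      ≤ Real.exp (-(-1 / 4 * m / ‖v‖ ^ 2) * ((4 / 5) ^ 2 * ‖v‖ ^ 2))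
        * Real.exp (-(9 / 50)) ^ m := by
        gcongr
    _ = Real.exp (-(1 / 50) * m) := by
        rw [← Real.exp_nat_mul, ← Real.exp_add]
        congr 1
        field_simp
        ring

end

/-! ### Nets in finite-dimensional balls. -/

section Covering

open Module Metric

variable {E : Type*} [NormedAddCommGroup E] [NormedSpace ℝ E] [FiniteDimensional ℝ E]

/-- A volume bound on the size of an `r`-separated set in a ball. -/
lemma card_le_of_separated {ρ r : ℝ} (hρ : 0 ≤ ρ) (hr : 0 < r) (s : Finset E)
    (hs : ∀ c ∈ s, ‖c‖ ≤ ρ) (h : ∀ c ∈ s, ∀ d ∈ s, c ≠ d → r ≤ ‖c - d‖) :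
    (s.card : ℝ) ≤ (1 + 2 * ρ / r) ^ finrank ℝ E := by
  borelize E
  let ν : Measure E := Measure.addHaar
  have hr2 : 0 < r / 2 := by positivity
  have hR : 0 < r / 2 + ρ := by positivity
  have D : Set.Pairwise (s : Set E) (Function.onFun Disjoint fun c => ball (c : E) (r / 2)) := by
    rintro c hc d hd hcd
    apply ball_disjoint_ball
    rw [dist_eq_norm]
    have := h c hc d hd hcd
    linarith
  have hsub : (⋃ c ∈ s, ball (c : E) (r / 2)) ⊆ ball (0 : E) (r / 2 + ρ) := by
    refine Set.iUnion₂_subset fun x hx => ball_subset_ball' ?_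
    rw [dist_zero_right]
    exact add_le_add le_rfl (hs x hx)
  have I : (s.card : ENNReal) * ENNReal.ofReal ((r / 2) ^ finrank ℝ E) * ν (ball 0 1) ≤
      ENNReal.ofReal ((r / 2 + ρ) ^ finrank ℝ E) * ν (ball 0 1) :=
    calc
      _ = ν (⋃ c ∈ s, ball (c : E) (r / 2)) := by
        rw [measure_biUnion_finset D fun c _ => measurableSet_ball]
        simp only [ν.addHaar_ball_of_pos _ hr2]
        simp only [Finset.sum_const, nsmul_eq_mul, mul_assoc]
      _ ≤ ν (ball (0 : E) (r / 2 + ρ)) := measure_mono hsub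
      _ = _ := by simp only [ν.addHaar_ball_of_pos _ hR]
  have J := (ENNReal.mul_le_mul_iff_left (measure_ball_pos ν _ zero_lt_one).ne'
    measure_ball_lt_top.ne).1 I
  have K := ENNReal.toReal_le_of_le_ofReal (by positivity) J
  rw [ENNReal.toReal_mul, ENNReal.toReal_ofReal (by positivity), ENNReal.toReal_natCast,
    ← le_div_iff₀ (by positivity), ← div_pow] at K
  refine K.trans_eq ?_
  congr 1
  field_simp

/-- A ball in a finite-dimensional space has an `r`-net of size exponential in the dimension. -/
lemma exists_net {ρ r : ℝ} (hρ : 0 ≤ ρ) (hr : 0 < r) :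
    ∃ s : Finset E, (∀ c ∈ s, ‖c‖ ≤ ρ) ∧ (∀ x : E, ‖x‖ ≤ ρ → ∃ c ∈ s, ‖x - c‖ ≤ r) ∧
      (s.card : ℝ) ≤ (1 + 2 * ρ / r) ^ finrank ℝ E := by
  classical
  let P : ℕ → Prop := fun n => ∃ s : Finset E, (∀ c ∈ s, ‖c‖ ≤ ρ) ∧
    (∀ c ∈ s, ∀ d ∈ s, c ≠ d → r ≤ ‖c - d‖) ∧ s.card = n
  let b := ⌊(1 + 2 * ρ / r) ^ finrank ℝ E⌋₊
  have hb : ∀ n, P n → n ≤ b := by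
    rintro n ⟨s, h1, h2, rfl⟩
    exact Nat.le_floor (card_le_of_separated hρ hr s h1 h2)
  have h0 : P 0 := ⟨∅, by simp, by simp, rfl⟩
  -- A separated set of greatest cardinality is a net: a point far from all of it could be added.
  -- The volume bound ensures that a greatest cardinality exists.
  obtain ⟨s, h1, h2, h3⟩ := Nat.findGreatest_spec (P := P) (Nat.zero_le b) h0
  refine ⟨s, h1, fun x hx => ?_, card_le_of_separated hρ hr s h1 h2⟩
  by_contra! hcon
  have hxs : x ∉ s := fun hxs => by
    have := hcon x hxs
    rw [sub_self, norm_zero] at this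
    linarith
  have hP : P (s.card + 1) := by
    refine ⟨insert x s, ?_, ?_, Finset.card_insert_of_notMem hxs⟩
    · intro c hc
      rcases Finset.mem_insert.1 hc with rfl | hc
      exacts [hx, h1 c hc]
    · intro c hc d hd hcd
      rcases Finset.mem_insert.1 hc with rfl | hc' <;> rcases Finset.mem_insert.1 hd with rfl | hd'
      · exact absurd rfl hcd
      · exact (hcon d hd').le
      · rw [norm_sub_rev]; exact (hcon c hc').le
      · exact h2 c hc' d hd' hcd
  have := Nat.le_findGreatest (hb _ hP) hP
  omega

end Covering

/-! ### Chaining and the set-restricted eigenvalue condition. -/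

section

open Module

/-- If a linear map stretches the differences of consecutive net points in a controlled way, then
it maps the image of a Lipschitz function close to the image of the coarsest net. -/
lemma norm_map_sub_le_of_chain {E V W : Type*} [NormedAddCommGroup E] [NormedAddCommGroup V]
    [NormedSpace ℝ V] [NormedAddCommGroup W] [NormedSpace ℝ W] (T : V →L[ℝ] W) (f : E → V)
    {L r : ℝ} (hL : 0 ≤ L) (hr : 0 ≤ r) (x : E) (a : ℕ → E)
    (hlip : ∀ i, ‖f (a i) - f x‖ ≤ L * ‖a i - x‖) (ha : ∀ i, ‖a i - x‖ ≤ r / 2 ^ i)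
    (hT : ∀ i, ‖T (f (a i) - f (a (i + 1)))‖ ≤ 2 * (i + 1) * ‖f (a i) - f (a (i + 1))‖) :
    ‖T (f x - f (a 0))‖ ≤ 12 * L * r := by
  have hd : ∀ i, ‖f (a i) - f x‖ ≤ L * (r / 2 ^ i) := fun i =>
    (hlip i).trans (mul_le_mul_of_nonneg_left (ha i) hL)
  have hstep : ∀ i, ‖f (a i) - f (a (i + 1))‖ ≤ 3 / 2 * (L * (r / 2 ^ i)) := by
    intro i
    have h1 := hd i
    have h2 := hd (i + 1)
    have h3 : L * (r / 2 ^ (i + 1)) = L * (r / 2 ^ i) / 2 := by rw [pow_succ]; field_simp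
    have h4 := norm_sub_le_norm_sub_add_norm_sub (f (a i)) (f x) (f (a (i + 1)))
    rw [norm_sub_rev (f x)] at h4
    linarith
  -- The bracket is the closed form of the partial sum of `(i + 1) / 2 ^ i`, whose limit `4` gives
  -- the constant `12`.
  have hind : ∀ n : ℕ, ‖T (f (a n) - f (a 0))‖ ≤ 3 * L * r * (4 - (2 * n + 4) / 2 ^ n) := by
    intro n
    induction n with
    | zero => simp
    | succ n ih =>
      have h1 : T (f (a (n + 1)) - f (a 0))
          = T (f (a n) - f (a 0)) - T (f (a n) - f (a (n + 1))) := by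
        rw [← map_sub]; congr 1; abel
      rw [h1]
      refine (norm_sub_le _ _).trans ?_
      have h2 : ‖T (f (a n) - f (a (n + 1)))‖ ≤ 2 * (n + 1) * (3 / 2 * (L * (r / 2 ^ n))) :=
        (hT n).trans (mul_le_mul_of_nonneg_left (hstep n) (by positivity))
      refine (add_le_add ih h2).trans_eq ?_
      rw [pow_succ]
      push_cast
      field_simp
      ring
  have hlim : Filter.Tendsto (fun n => f (a n)) Filter.atTop (nhds (f x)) := by
    rw [tendsto_iff_norm_sub_tendsto_zero]
    refine squeeze_zero (fun _ => norm_nonneg _) hd ?_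
    have h0 : Filter.Tendsto (fun n : ℕ => (1 / 2 : ℝ) ^ n) Filter.atTop (nhds 0) :=
      tendsto_pow_atTop_nhds_zero_of_lt_one (by norm_num) (by norm_num)
    have := h0.const_mul (L * r)
    rw [mul_zero] at this
    refine this.congr fun n => ?_
    rw [one_div, inv_pow]
    ring
  have hlim2 : Filter.Tendsto (fun n => ‖T (f (a n) - f (a 0))‖) Filter.atTop
      (nhds ‖T (f x - f (a 0))‖) :=
    ((T.continuous.tendsto _).comp (hlim.sub_const _)).norm
  refine le_of_tendsto' hlim2 fun n => (hind n).trans ?_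
  have h1 : (0 : ℝ) ≤ (2 * n + 4) / 2 ^ n := by positivity
  have h2 : 0 ≤ 3 * L * r := by positivity
  nlinarith

variable {ι : Type} [Fintype ι] [DecidableEq ι] {m : ℕ}

lemma measurable_norm_toEuclideanLin (v : EuclideanSpace ℝ ι) :
    Measurable fun A : Fin m → ι → ℝ => ‖Matrix.toEuclideanLin (Matrix.of A) v‖ := by
  have h : (fun A : Fin m → ι → ℝ => ‖Matrix.toEuclideanLin (Matrix.of A) v‖)
      = fun A => √(∑ i, (∑ j, A i j * v j) ^ 2) := by
    funext A
    rw [← norm_sq_toEuclideanLin, Real.sqrt_sq (norm_nonneg _)]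
  rw [h]
  fun_prop

/-- The failure probability in the chaining argument. -/
lemma tsum_failure_le {m : ℕ} {M : ℝ} (hm : 400 ≤ m) (hM : 2000 * M ≤ m) :
    (∑' i : ℕ, ENNReal.ofReal (Real.exp (39 * (i + 1) * M) * Real.exp
        (-(1 / 8) * (2 * ((i : ℝ) + 1)) ^ 2 * m)))
      + ENNReal.ofReal (Real.exp (13 * M) * Real.exp (-(1 / 50) * m))
      + ENNReal.ofReal (Real.exp (-(1 / 8) * 2 ^ 2 * m))
      ≤ ENNReal.ofReal (Real.exp (-(1 / 200) * m)) := by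
  have hm' : (400 : ℝ) ≤ m := by exact_mod_cast hm
  set q : ℝ := Real.exp (-(1 / 4) * m)
  have hq0 : 0 < q := Real.exp_pos _
  have hquarter : Real.exp (-(1 / 200) * m) ≤ 1 / 4 := by
    calc Real.exp (-(1 / 200) * m) ≤ Real.exp (-2) := Real.exp_le_exp.2 (by linarith)
      _ = (Real.exp 1)⁻¹ ^ 2 := by rw [← Real.exp_neg, ← Real.exp_nat_mul]; norm_num
      _ ≤ 2⁻¹ ^ 2 := by
        gcongr
        have := Real.add_one_le_exp (1 : ℝ)
        linarith
      _ = 1 / 4 := by norm_num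
  have hqs : q ≤ Real.exp (-(1 / 100) * m) := Real.exp_le_exp.2 (by linarith)
  have hs : Real.exp (-(1 / 100) * m) ≤ 1 / 4 * Real.exp (-(1 / 200) * m) := by
    have : Real.exp (-(1 / 100) * m) = Real.exp (-(1 / 200) * m) * Real.exp (-(1 / 200) * m) := by
      rw [← Real.exp_add]; congr 1; ring
    rw [this]
    gcongr
  have hqhalf : q ≤ 1 / 2 := by linarith
  have hsum : HasSum (fun i : ℕ => q * q ^ i) (q * (1 - q)⁻¹) :=
    (hasSum_geometric_of_lt_one hq0.le (by linarith)).mul_left q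
  have h1 : (∑' i : ℕ, ENNReal.ofReal (Real.exp (39 * (i + 1) * M) * Real.exp
        (-(1 / 8) * (2 * ((i : ℝ) + 1)) ^ 2 * m))) ≤ ENNReal.ofReal (2 * q) := by
    calc _ ≤ ∑' i : ℕ, ENNReal.ofReal (q * q ^ i) := by
          -- The tail exponent `(i + 1) ^ 2 * m / 2` absorbs the entropy `39 * (i + 1) * M` and
          -- leaves at least `(i + 1) * m / 4`, so a geometric series dominates.
          refine ENNReal.tsum_le_tsum fun i => ENNReal.ofReal_le_ofReal ?_
          rw [← Real.exp_add, ← pow_succ', ← Real.exp_nat_mul]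
          apply Real.exp_le_exp.2
          push_cast
          have hi : (0 : ℝ) ≤ i := by positivity
          have h2 : ((i : ℝ) + 1) * m ≤ (i + 1) ^ 2 * m := by
            gcongr
            nlinarith
          have h3 : ((i : ℝ) + 1) * (2000 * M) ≤ (i + 1) * m := by gcongr
          have h4 : 0 ≤ ((i : ℝ) + 1) * m := by positivity
          nlinarith
      _ = ENNReal.ofReal (q * (1 - q)⁻¹) := by
          rw [← ENNReal.ofReal_tsum_of_nonneg (fun _ => by positivity) hsum.summable, hsum.tsum_eq]
      _ ≤ ENNReal.ofReal (2 * q) := by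
          apply ENNReal.ofReal_le_ofReal
          have : (1 - q)⁻¹ ≤ 2 := by
            rw [show (2 : ℝ) = (1 / 2)⁻¹ by norm_num]
            exact inv_anti₀ (by norm_num) (by linarith)
          nlinarith
  refine (add_le_add (add_le_add h1 le_rfl) le_rfl).trans ?_
  rw [← ENNReal.ofReal_add (by positivity) (by positivity),
    ← ENNReal.ofReal_add (by positivity) (by positivity)]
  apply ENNReal.ofReal_le_ofReal
  have h2 : Real.exp (13 * M) * Real.exp (-(1 / 50) * m) ≤ Real.exp (-(1 / 100) * m) := by
    rw [← Real.exp_add]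
    exact Real.exp_le_exp.2 (by linarith)
  have h3 : Real.exp (-(1 / 8) * 2 ^ 2 * m) ≤ Real.exp (-(1 / 100) * m) :=
    Real.exp_le_exp.2 (by linarith)
  linarith

/-- With high probability, a Gaussian matrix satisfies the set-restricted eigenvalue condition on
the image of a ball under a Lipschitz function. -/
lemma exists_event_restricted_eigenvalue {E : Type*} [NormedAddCommGroup E] [NormedSpace ℝ E]
    [FiniteDimensional ℝ E] (f : E → EuclideanSpace ℝ ι) {ρ L r M : ℝ} (hρ : 0 ≤ ρ) (hL : 0 ≤ L)
    (hr : 0 < r) (hlip : ∀ a b : E, ‖a‖ ≤ ρ → ‖b‖ ≤ ρ → ‖f a - f b‖ ≤ L * ‖a - b‖)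
    (hM : 2000 * M ≤ m) (hm : 400 ≤ m)
    (hcard : ∀ i : ℕ, (1 + 2 * ρ / (r / 2 ^ i)) ^ finrank ℝ E ≤ Real.exp (13 * (i + 1) * M))
    (z : E) (x : EuclideanSpace ℝ ι) :
    ∃ S : Set (Fin m → ι → ℝ), MeasurableSet S ∧
      ENNReal.ofReal (1 - Real.exp (-(1 / 200) * m)) ≤ gaussianMatrix m ι S ∧
      ∀ A ∈ S, ‖Matrix.toEuclideanLin (Matrix.of A) (f z - x)‖ ≤ 2 * ‖f z - x‖ ∧
        ∀ C : E, ‖C‖ ≤ ρ → 4 / 5 * ‖f C - f z‖ ≤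
          ‖Matrix.toEuclideanLin (Matrix.of A) (f C - f z)‖ + 13 * (L * r) := by
  have hm0 : m ≠ 0 := by omega
  choose S hS1 hS2 hS3 using fun i : ℕ => exists_net (E := E) hρ (r := r / 2 ^ i) (by positivity)
  have hS4 : ∀ i, ((S i).card : ℝ) ≤ Real.exp (13 * (i + 1) * M) := fun i =>
    (hS3 i).trans (hcard i)
  let up : ℝ → EuclideanSpace ℝ ι → Set (Fin m → ι → ℝ) := fun s v =>
    {A | s * ‖v‖ < ‖Matrix.toEuclideanLin (Matrix.of A) v‖}
  let lo : EuclideanSpace ℝ ι → Set (Fin m → ι → ℝ) := fun v =>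
    {A | ‖Matrix.toEuclideanLin (Matrix.of A) v‖ < 4 / 5 * ‖v‖}
  have hup : ∀ s v, MeasurableSet (up s v) := fun s v =>
    measurableSet_lt measurable_const (measurable_norm_toEuclideanLin v)
  have hlo : ∀ v, MeasurableSet (lo v) := fun v =>
    measurableSet_lt (measurable_norm_toEuclideanLin v) measurable_const
  -- Three kinds of failure: a chain link is stretched too much, a coarse difference from `f z`
  -- shrinks, or the single residual `f z - x` is stretched. Only the first involves pairs of net
  -- points.
  let bad : Set (Fin m → ι → ℝ) :=
    (⋃ i : ℕ, ⋃ p ∈ S i ×ˢ S (i + 1), up (2 * (i + 1)) (f p.1 - f p.2))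
      ∪ (⋃ a ∈ S 0, lo (f a - f z)) ∪ up 2 (f z - x)
  have hbad : MeasurableSet bad := by
    refine ((MeasurableSet.iUnion fun i => ?_).union ?_).union (hup _ _)
    · exact Finset.measurableSet_biUnion _ fun p _ => hup _ _
    · exact Finset.measurableSet_biUnion _ fun p _ => hlo _
  have hPbad : gaussianMatrix m ι bad ≤ ENNReal.ofReal (Real.exp (-(1 / 200) * m)) := by
    refine le_trans ?_ (tsum_failure_le hm hM)
    refine (measure_union_le _ _).trans (add_le_add ((measure_union_le _ _).trans
      (add_le_add ?_ ?_)) (gaussianMatrix_upper_tail hm0 _ le_rfl))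
    · refine (measure_iUnion_le _).trans (ENNReal.tsum_le_tsum fun i => ?_)
      refine (measure_biUnion_finset_le _ _).trans ?_
      refine (Finset.sum_le_card_nsmul _ _ _ fun p _ => gaussianMatrix_upper_tail hm0 _ ?_).trans ?_
      · have : (0 : ℝ) ≤ i := by positivity
        linarith
      · rw [nsmul_eq_mul, ← ENNReal.ofReal_natCast, ← ENNReal.ofReal_mul (by positivity)]
        apply ENNReal.ofReal_le_ofReal
        gcongr
        rw [Finset.card_product]
        push_cast
        refine (mul_le_mul (hS4 i) (hS4 (i + 1)) (by positivity) (by positivity)).trans ?_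
        rw [← Real.exp_add]
        apply Real.exp_le_exp.2
        -- The two nets contribute `13 * (i + 1) + 13 * (i + 2) = 26 * i + 39`; replacing this by
        -- `39 * (i + 1)` needs `M ≥ 0`, which `hcard 0` forces.
        have hM0 : 0 ≤ M := by
          have h1 := hcard 0
          have h2 : (1 : ℝ) ≤ (1 + 2 * ρ / (r / 2 ^ 0)) ^ finrank ℝ E := by
            apply one_le_pow₀
            have : 0 ≤ 2 * ρ / (r / 2 ^ 0) := by positivity
            linarith
          have h3 := Real.one_le_exp_iff.1 (h2.trans h1)
          norm_num at h3
          linarith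
        push_cast
        have : (0 : ℝ) ≤ i * M := by positivity
        nlinarith
    · refine (measure_biUnion_finset_le _ _).trans ?_
      refine (Finset.sum_le_card_nsmul _ _ _ fun p _ => gaussianMatrix_lower_tail hm0 _).trans ?_
      rw [nsmul_eq_mul, ← ENNReal.ofReal_natCast, ← ENNReal.ofReal_mul (by positivity)]
      apply ENNReal.ofReal_le_ofReal
      gcongr
      simpa using hS4 0
  refine ⟨badᶜ, hbad.compl, ?_, ?_⟩
  · rw [prob_compl_eq_one_sub hbad, ENNReal.ofReal_sub _ (by positivity), ENNReal.ofReal_one]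
    exact tsub_le_tsub_left hPbad _
  · intro A hA
    simp only [bad, up, lo, Set.mem_compl_iff, Set.mem_union, Set.mem_iUnion, Set.mem_ofPred_eq,
      not_or, not_exists, not_lt, Finset.mem_product] at hA
    obtain ⟨⟨h1, h2⟩, h3⟩ := hA
    refine ⟨h3, fun C hC => ?_⟩
    choose a ha1 ha2 using fun i => hS2 i C hC
    have hch := norm_map_sub_le_of_chain
      (LinearMap.toContinuousLinearMap (Matrix.toEuclideanLin (Matrix.of A))) f hL hr.le C a
      (fun i => hlip _ _ (hS1 i _ (ha1 i)) hC) (fun i => by rw [norm_sub_rev]; exact ha2 i)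
      (fun i => h1 i (a i, a (i + 1)) ⟨ha1 i, ha1 (i + 1)⟩)
    rw [LinearMap.coe_toContinuousLinearMap'] at hch
    have h4 := h2 (a 0) (ha1 0)
    have h5 : ‖f C - f (a 0)‖ ≤ L * r := by
      refine (hlip _ _ hC (hS1 0 _ (ha1 0))).trans (mul_le_mul_of_nonneg_left ?_ hL)
      simpa using ha2 0
    have h6 := norm_sub_le_norm_sub_add_norm_sub (f C) (f (a 0)) (f z)
    have h7 : Matrix.toEuclideanLin (Matrix.of A) (f (a 0) - f z)
        = Matrix.toEuclideanLin (Matrix.of A) (f C - f z)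
          - Matrix.toEuclideanLin (Matrix.of A) (f C - f (a 0)) := by
      rw [← map_sub]; congr 1; abel
    rw [h7] at h4
    have h8 := norm_sub_le (Matrix.toEuclideanLin (Matrix.of A) (f C - f z))
      (Matrix.toEuclideanLin (Matrix.of A) (f C - f (a 0)))
    have h9 : 0 ≤ L * r := by positivity
    -- The error is `4 / 5 * (L * r)` from moving to the coarse net plus `12 * (L * r)` from the
    -- chain, rounded up to `13 * (L * r)`.
    linarith

end

/-! ### Frobenius and spectral norms. -/

section Matrices

variable {P Q S : Type*} [Fintype P] [Fintype Q] [Fintype S]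

/-- The entries of a matrix as a vector, so that the Euclidean norm is the Frobenius norm. -/
def entries (B : Matrix P Q ℝ) : EuclideanSpace ℝ (P × Q) := WithLp.toLp 2 fun t => B t.1 t.2

lemma norm_entries_sq (B : Matrix P Q ℝ) : ‖entries B‖ ^ 2 = ∑ s, ∑ p, B p s ^ 2 := by
  rw [EuclideanSpace.real_norm_sq_eq, Fintype.sum_prod_type_right]
  rfl

lemma norm_entries_le_of_abs_le {B B' : Matrix P Q ℝ} (h : ∀ p q, |B p q| ≤ |B' p q|) :
    ‖entries B‖ ≤ ‖entries B'‖ := by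
  rw [← sq_le_sq₀ (norm_nonneg _) (norm_nonneg _), norm_entries_sq, norm_entries_sq]
  exact Finset.sum_le_sum fun s _ => Finset.sum_le_sum fun p _ => sq_le_sq.2 (h p s)

open scoped Matrix.Norms.L2Operator

variable [DecidableEq Q]

lemma norm_toLp_mulVec_le (B : Matrix P Q ℝ) (x : Q → ℝ) :
    ‖(WithLp.toLp 2 (B.mulVec x) : EuclideanSpace ℝ P)‖
      ≤ ‖B‖ * ‖(WithLp.toLp 2 x : EuclideanSpace ℝ Q)‖ :=
  Matrix.l2_opNorm_mulVec B (WithLp.toLp 2 x)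

/-- Cauchy–Schwarz in each row. Entrywise contractions such as ReLU are controlled in the Frobenius
norm; this returns to the spectral norm needed for the next layer. -/
lemma l2_opNorm_le_norm_entries (B : Matrix P Q ℝ) : ‖B‖ ≤ ‖entries B‖ := by
  rw [Matrix.l2_opNorm_def]
  refine ContinuousLinearMap.opNorm_le_bound _ (norm_nonneg _) fun x => ?_
  rw [← sq_le_sq₀ (norm_nonneg _) (by positivity), mul_pow, EuclideanSpace.real_norm_sq_eq,
    EuclideanSpace.real_norm_sq_eq, EuclideanSpace.real_norm_sq_eq, Fintype.sum_prod_type,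
    Finset.sum_mul]
  exact Finset.sum_le_sum fun p _ => Finset.sum_mul_sq_le_sq_mul_sq _ _ _

lemma norm_entries_mul_le (B : Matrix P Q ℝ) (W : Matrix Q S ℝ) :
    ‖entries (B * W)‖ ≤ ‖B‖ * ‖entries W‖ := by
  rw [← sq_le_sq₀ (norm_nonneg _) (by positivity), mul_pow, norm_entries_sq, norm_entries_sq,
    Finset.mul_sum]
  refine Finset.sum_le_sum fun s _ => ?_
  have h := pow_le_pow_left₀ (norm_nonneg _) (norm_toLp_mulVec_le B fun q => W q s) 2
  rw [mul_pow, EuclideanSpace.real_norm_sq_eq, EuclideanSpace.real_norm_sq_eq] at h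
  exact h

end Matrices

/-! ### Linearity of convolution and upsampling; the output map is a contraction. -/

section Linearity

variable {D ℓ : ℕ} {s : Fin D → ℕ}

lemma FilterKind.kernel_eq_sum (F : FilterKind D ℓ) (c : F.Coeff → ℝ) :
    F.kernel c = ∑ e, c e • F.kernel (Pi.single e 1) := by
  cases F with
  | fixed w =>
    funext q
    have : ∀ f : Unit → ℝ, ∑ e : (FilterKind.fixed w : FilterKind D ℓ).Coeff, f e = f () :=
      fun f => Fintype.sum_unique f
    rw [Finset.sum_apply]
    refine Eq.trans ?_ (this _).symm
    have h1 : (Pi.single () 1 : (FilterKind.fixed w : FilterKind D ℓ).Coeff → ℝ) () = 1 :=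
      Pi.single_eq_same (M := fun _ : (FilterKind.fixed w : FilterKind D ℓ).Coeff => ℝ) () 1
    simp only [FilterKind.kernel, Pi.smul_apply, smul_eq_mul]
    rw [h1, one_mul]
  | learned => exact pi_eq_sum_univ' c

lemma conv_sum_kernel {α : Type*} (t : Finset α) (a : α → ℝ) (c : α → (Fin D → Fin ℓ) → ℝ)
    (z : Pixels s → ℝ) : conv (∑ e ∈ t, a e • c e) z = ∑ e ∈ t, a e • conv (c e) z := by
  funext p
  simp only [conv, Finset.sum_apply, Pi.smul_apply, smul_eq_mul, Finset.sum_mul, Finset.mul_sum]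
  rw [Finset.sum_comm]
  simp only [mul_assoc]

lemma conv_sum_signal {α : Type*} (t : Finset α) (a : α → ℝ) (c : (Fin D → Fin ℓ) → ℝ)
    (z : α → Pixels s → ℝ) : conv c (∑ e ∈ t, a e • z e) = ∑ e ∈ t, a e • conv c (z e) := by
  funext p
  simp only [conv, Finset.sum_apply, Pi.smul_apply, smul_eq_mul, Finset.mul_sum]
  rw [Finset.sum_comm]
  simp only [mul_left_comm]

lemma upsample_sum {α : Type*} (t : Finset α) (a : α → ℝ) (f : ℕ) (z : α → Pixels s → ℝ) :
    upsample f (∑ e ∈ t, a e • z e) = ∑ e ∈ t, a e • upsample f (z e) := by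
  funext p
  simp only [upsample, Finset.sum_apply, Pi.smul_apply, smul_eq_mul]
  split_ifs <;> simp

end Linearity

lemma OutputMap.abs_apply_sub_le (o : OutputMap) (x y : ℝ) :
    |o.apply x - o.apply y| ≤ |x - y| := by
  cases o with
  | identity => exact le_rfl
  | sigmoid =>
    have h := Convex.norm_image_sub_le_of_norm_deriv_le (f := Real.sigmoid) (C := 1)
      (s := Set.univ) (x := y) (y := x) (fun z _ => differentiableAt_sigmoid)
      (fun z _ => by
        rw [Real.deriv_sigmoid, Real.norm_eq_abs, abs_le]
        have h1 := Real.sigmoid_pos z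
        have h2 := Real.sigmoid_lt_one z
        constructor <;> nlinarith) convex_univ trivial trivial
    simpa [OutputMap.apply] using h

/-! ### Lipschitz bounds for the generator. -/

namespace ConvGenerator

variable (G : ConvGenerator)

/-- The linear part of a layer. -/
def preactivation (i : ℕ) (θ : (G.filter i).Coeff × Fin G.channels × Fin G.channels → ℝ)
    (B : Matrix (Pixels (G.size i)) (Fin G.channels) ℝ) :
    Matrix (Pixels (G.size (i + 1))) (Fin G.channels) ℝ :=
  Matrix.of fun p s => ∑ e, conv ((G.filter i).kernel (Pi.single e 1))
    (upsample (G.factor i) (B.mulVec fun j => θ (e, s, j))) p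

variable {G} {i : ℕ} (θ θ' : (G.filter i).Coeff × Fin G.channels × Fin G.channels → ℝ)
  (B B' : Matrix (Pixels (G.size i)) (Fin G.channels) ℝ)

lemma mulVec_eq_sum (w : Fin G.channels → ℝ) :
    B.mulVec w = ∑ j, w j • fun p => B p j := by
  funext p
  simp [Matrix.mulVec, dotProduct, mul_comm]

/-- By linearity the channels can be mixed first and the parameter-free operator of `LayerNormLE`
applied afterwards. The parameters then act on `B` as a matrix multiplication, which makes its
spectral norm the relevant one. -/
lemma layer_apply (p : Pixels (G.size (i + 1))) (s : Fin G.channels) :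
    G.layer i θ B p s = max 0 (G.preactivation i θ B p s) := by
  simp only [layer, preactivation, Matrix.of_apply]
  congr 1
  simp_rw [mulVec_eq_sum, upsample_sum]
  have h1 : ∀ j, conv ((G.filter i).kernel fun c => θ (c, s, j))
      (upsample (G.factor i) fun p' => B p' j) p
      = ∑ e, θ (e, s, j) * conv ((G.filter i).kernel (Pi.single e 1))
        (upsample (G.factor i) fun p' => B p' j) p := by
    intro j
    rw [FilterKind.kernel_eq_sum]
    exact (congrFun (conv_sum_kernel _ _ _ _) p).trans (Finset.sum_apply _ _ _)
  simp_rw [h1]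
  rw [Finset.sum_comm]
  refine Finset.sum_congr rfl fun e _ => ?_
  exact ((congrFun (conv_sum_signal _ _ _ _) p).trans (Finset.sum_apply _ _ _)).symm

lemma preactivation_sub :
    G.preactivation i θ B - G.preactivation i θ' B'
      = G.preactivation i (θ - θ') B + G.preactivation i θ' (B - B') := by
  have hconv : ∀ (s : Fin G.dim → ℕ) (c : (Fin G.dim → Fin G.taps) → ℝ) (z z' : Pixels s → ℝ),
      conv c (z + z') = conv c z + conv c z' := by
    intro s c z z'
    funext p
    simp [conv, mul_add, Finset.sum_add_distrib]
  have hup : ∀ (z z' : Pixels (G.size i) → ℝ), upsample (G.factor i) (z + z')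
      = upsample (G.factor i) z + upsample (G.factor i) z' := by
    intro z z'
    funext p
    simp only [upsample, Pi.add_apply]
    split_ifs <;> simp
  rw [sub_eq_iff_eq_add]
  ext p s
  simp only [preactivation, Matrix.of_apply, Matrix.add_apply]
  rw [← Finset.sum_add_distrib, ← Finset.sum_add_distrib]
  refine Finset.sum_congr rfl fun e _ => ?_
  have hsplit : (B.mulVec fun j => θ (e, s, j)) = (B.mulVec fun j => (θ - θ') (e, s, j))
      + ((B - B').mulVec fun j => θ' (e, s, j)) + B'.mulVec fun j => θ' (e, s, j) := by
    have : (fun j => (θ - θ') (e, s, j)) = (fun j => θ (e, s, j)) - fun j => θ' (e, s, j) := rfl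
    rw [this, Matrix.mulVec_sub, Matrix.sub_mulVec]
    abel
  rw [hsplit, hup, hup, hconv, hconv]
  rfl

open scoped Matrix.Norms.L2Operator

variable {κ : ℝ}

/-- For each output channel, `κ` bounds the convolution and the spectral norm of `B` bounds the
mixing; squares add up over output channels. Pairing the spectral norm of `B` with the Euclidean
norm of `θ` avoids any factor depending on the number of channels. -/
lemma norm_preactivation_le (hκ : 0 ≤ κ) (h : G.LayerNormLE i κ) :
    ‖entries (G.preactivation i θ B)‖
      ≤ κ * ‖B‖ * ‖(WithLp.toLp 2 θ : EuclideanSpace ℝ _)‖ := by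
  have hθ : ‖(WithLp.toLp 2 θ : EuclideanSpace ℝ _)‖ ^ 2 = ∑ s, ∑ e, ∑ j, θ (e, s, j) ^ 2 := by
    rw [EuclideanSpace.real_norm_sq_eq, Fintype.sum_prod_type]
    simp_rw [Fintype.sum_prod_type]
    exact Finset.sum_comm
  rw [← sq_le_sq₀ (norm_nonneg _) (by positivity), mul_pow, norm_entries_sq, hθ, Finset.mul_sum]
  refine Finset.sum_le_sum fun s _ => ?_
  let z : (G.filter i).Coeff → EuclideanSpace ℝ (Pixels (G.size i)) :=
    fun e => WithLp.toLp 2 (B.mulVec fun j => θ (e, s, j))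
  have h1 : ‖(WithLp.toLp 2 (fun p => G.preactivation i θ B p s) :
      EuclideanSpace ℝ (Pixels (G.size (i + 1))))‖ ≤ κ * √(∑ e, ‖z e‖ ^ 2) := h z
  have h2 : ∑ p, G.preactivation i θ B p s ^ 2 ≤ (κ * √(∑ e, ‖z e‖ ^ 2)) ^ 2 := by
    refine le_trans (le_of_eq ?_) (pow_le_pow_left₀ (norm_nonneg _) h1 2)
    rw [EuclideanSpace.real_norm_sq_eq]
  rw [mul_pow, Real.sq_sqrt (Finset.sum_nonneg fun _ _ => sq_nonneg _)] at h2
  refine h2.trans ?_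
  rw [mul_pow, mul_assoc]
  refine mul_le_mul_of_nonneg_left ?_ (sq_nonneg κ)
  rw [Finset.mul_sum]
  refine Finset.sum_le_sum fun e _ => ?_
  have h3 := pow_le_pow_left₀ (norm_nonneg _) (norm_toLp_mulVec_le B fun j => θ (e, s, j)) 2
  rwa [mul_pow, EuclideanSpace.real_norm_sq_eq (WithLp.toLp 2 fun j => θ (e, s, j))] at h3

lemma norm_layer_le (hκ : 0 ≤ κ) (h : G.LayerNormLE i κ) :
    ‖G.layer i θ B‖ ≤ κ * ‖B‖ * ‖(WithLp.toLp 2 θ : EuclideanSpace ℝ _)‖ := by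
  refine (l2_opNorm_le_norm_entries _).trans (le_trans ?_ (norm_preactivation_le θ B hκ h))
  refine norm_entries_le_of_abs_le fun p s => ?_
  rw [layer_apply, abs_of_nonneg (le_max_left _ _)]
  exact max_le (abs_nonneg _) (le_abs_self _)

lemma norm_layer_sub_le (hκ : 0 ≤ κ) (h : G.LayerNormLE i κ) :
    ‖G.layer i θ B - G.layer i θ' B'‖
      ≤ κ * ‖B‖ * ‖(WithLp.toLp 2 (θ - θ') : EuclideanSpace ℝ _)‖
        + κ * ‖B - B'‖ * ‖(WithLp.toLp 2 θ' : EuclideanSpace ℝ _)‖ := by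
  refine (l2_opNorm_le_norm_entries _).trans ?_
  refine le_trans (norm_entries_le_of_abs_le
    (B' := G.preactivation i θ B - G.preactivation i θ' B') fun p s => ?_) ?_
  · rw [Matrix.sub_apply, Matrix.sub_apply, layer_apply, layer_apply, max_comm 0, max_comm 0]
    exact abs_max_sub_max_le_abs _ _ _
  · rw [preactivation_sub]
    exact (norm_add_le (entries _) (entries _)).trans
      (add_le_add (norm_preactivation_le _ _ hκ h) (norm_preactivation_le _ _ hκ h))

variable (G)

/-- The norm of the parameters of layer `i`; the final linear combinations count as the layers from
`depth` on. -/
def blockNorm (C : G.Params) (i : ℕ) : ℝ :=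
  if h : i < G.depth then
    ‖(WithLp.toLp 2 fun t => C (Sum.inl ⟨⟨i, h⟩, t⟩) : EuclideanSpace ℝ
      ((G.filter i).Coeff × Fin G.channels × Fin G.channels))‖
  else ‖entries (Matrix.of fun j o => C (Sum.inr (j, o)))‖

variable {G}

lemma blockNorm_nonneg (C : G.Params) (i : ℕ) : 0 ≤ G.blockNorm C i := by
  unfold blockNorm; split_ifs <;> exact norm_nonneg _

lemma sum_blockNorm_sq (C : G.Params) :
    ∑ i ∈ Finset.range (G.depth + 1), G.blockNorm C i ^ 2 = ‖C‖ ^ 2 := by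
  rw [Finset.sum_range_succ, Finset.sum_range, EuclideanSpace.real_norm_sq_eq,
    Fintype.sum_sum_type, Fintype.sum_sigma]
  congr 1
  · refine Finset.sum_congr rfl fun i _ => ?_
    rw [blockNorm, dif_pos i.2, EuclideanSpace.real_norm_sq_eq]
  · rw [blockNorm, dif_neg (lt_irrefl _), EuclideanSpace.real_norm_sq_eq]
    rfl

lemma blockNorm_le (C : G.Params) {i : ℕ} (hi : i ≤ G.depth) : G.blockNorm C i ≤ ‖C‖ := by
  rw [← sq_le_sq₀ (blockNorm_nonneg _ _) (norm_nonneg _), ← sum_blockNorm_sq]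
  exact Finset.single_le_sum (f := fun i => G.blockNorm C i ^ 2) (fun i _ => sq_nonneg _)
    (Finset.mem_range.2 (by omega))

/-- The product of block norms is kept, since AM-GM later gains over bounding each factor by `μ`. -/
lemma norm_volume_le {ξ : ℝ} (hκ : 0 ≤ κ) (h : ∀ i < G.depth, G.LayerNormLE i κ)
    (hξ : G.inputNorm ≤ ξ) (C : G.Params) (i : ℕ) (hi : i ≤ G.depth) :
    ‖G.volume C i hi‖ ≤ ξ * κ ^ i * ∏ l ∈ Finset.range i, G.blockNorm C l := by
  induction i with
  | zero =>
    rw [Finset.range_zero, Finset.prod_empty, pow_zero, mul_one, mul_one]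
    exact hξ
  | succ i ih =>
    rw [volume]
    refine (norm_layer_le _ _ hκ (h i hi)).trans ?_
    have h1 := ih (by omega)
    rw [Finset.prod_range_succ, blockNorm, dif_pos (show i < G.depth from hi)]
    calc _ ≤ κ * (ξ * κ ^ i * ∏ l ∈ Finset.range i, G.blockNorm C l) * _ := by gcongr
      _ = _ := by ring

lemma norm_volume_le_pow {ξ μ : ℝ} (hκ : 0 ≤ κ) (h : ∀ i < G.depth, G.LayerNormLE i κ)
    (hξ : G.inputNorm ≤ ξ) {C : G.Params} (hC : ‖C‖ ≤ μ) (i : ℕ) (hi : i ≤ G.depth) :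
    ‖G.volume C i hi‖ ≤ ξ * (κ * μ) ^ i := by
  have hξ0 : 0 ≤ ξ := (norm_nonneg _).trans hξ
  refine (norm_volume_le hκ h hξ C i hi).trans ?_
  rw [mul_pow, ← mul_assoc]
  refine mul_le_mul_of_nonneg_left ?_ (by positivity)
  refine (Finset.prod_le_prod (fun l _ => blockNorm_nonneg _ _)
    fun l hl => (blockNorm_le C ?_).trans hC).trans_eq (by simp)
  have := Finset.mem_range.1 hl
  omega

/-- Changing the layers one at a time gives `i` terms, each with one factor `μ` replaced by `‖C -
C'‖`. The extra `μ` on the left avoids the exponent `i - 1`. -/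
lemma norm_volume_sub_le {ξ μ : ℝ} (hκ : 0 ≤ κ) (h : ∀ i < G.depth, G.LayerNormLE i κ)
    (hξ : G.inputNorm ≤ ξ) {C C' : G.Params} (hC : ‖C‖ ≤ μ) (hC' : ‖C'‖ ≤ μ) (i : ℕ)
    (hi : i ≤ G.depth) :
    ‖G.volume C i hi - G.volume C' i hi‖ * μ ≤ i * (ξ * (κ * μ) ^ i * ‖C - C'‖) := by
  have hξ0 : 0 ≤ ξ := (norm_nonneg _).trans hξ
  have hμ : 0 ≤ μ := (norm_nonneg _).trans hC
  induction i with
  | zero =>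
    have : G.volume C 0 hi = G.volume C' 0 hi := rfl
    rw [this, sub_self, norm_zero, Nat.cast_zero, zero_mul, zero_mul]
  | succ i ih =>
    have h1 := ih (by omega)
    have h2 := norm_volume_le_pow hκ h hξ hC i (by omega)
    have hb1 := blockNorm_le (C - C') (i := i) (by omega)
    have hb2 := (blockNorm_le C' (i := i) (by omega)).trans hC'
    rw [blockNorm, dif_pos (show i < G.depth from hi)] at hb1 hb2
    rw [volume, volume]
    have h3 := norm_layer_sub_le (fun t => C (Sum.inl ⟨⟨i, hi⟩, t⟩))
      (fun t => C' (Sum.inl ⟨⟨i, hi⟩, t⟩)) (G.volume C i (by omega)) (G.volume C' i (by omega))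
      hκ (h i hi)
    calc _ ≤ (κ * (ξ * (κ * μ) ^ i) * ‖C - C'‖
          + κ * ‖G.volume C i (by omega) - G.volume C' i (by omega)‖ * μ) * μ := by
          refine mul_le_mul_of_nonneg_right (h3.trans (add_le_add ?_ ?_)) hμ
          · exact mul_le_mul (by gcongr) hb1 (norm_nonneg _) (by positivity)
          · exact mul_le_mul_of_nonneg_left hb2 (by positivity)
      _ = κ * μ * (ξ * (κ * μ) ^ i) * ‖C - C'‖
          + κ * μ * (‖G.volume C i (by omega) - G.volume C' i (by omega)‖ * μ) := by ring
      _ ≤ κ * μ * (ξ * (κ * μ) ^ i) * ‖C - C'‖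
          + κ * μ * (i * (ξ * (κ * μ) ^ i * ‖C - C'‖)) := by gcongr
      _ = _ := by push_cast; ring

/-- The weights of the final linear combinations. -/
def outWeights (C : G.Params) : Matrix (Fin G.channels) (Fin G.outChannels) ℝ :=
  Matrix.of fun j o => C (Sum.inr (j, o))

lemma norm_outWeights (C : G.Params) : ‖entries (outWeights C)‖ = G.blockNorm C G.depth := by
  rw [blockNorm, dif_neg (lt_irrefl _), outWeights]

lemma norm_generate_sub_le_norm_entries (C C' : G.Params) :
    ‖G.generate C - G.generate C'‖ ≤ ‖entries (G.volume C G.depth le_rfl * outWeights C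
      - G.volume C' G.depth le_rfl * outWeights C')‖ :=
  norm_entries_le_of_abs_le
    (B := Matrix.of fun p o => G.generate C (p, o) - G.generate C' (p, o))
    fun _ _ => OutputMap.abs_apply_sub_le _ _ _

/-- A convolutional generator is Lipschitz on balls. -/
lemma norm_generate_sub_le {ξ μ : ℝ} (hκ : 0 ≤ κ) (h : ∀ i < G.depth, G.LayerNormLE i κ)
    (hξ : G.inputNorm ≤ ξ) {C C' : G.Params} (hC : ‖C‖ ≤ μ) (hC' : ‖C'‖ ≤ μ) :
    ‖G.generate C - G.generate C'‖ ≤ (G.depth + 1) * (ξ * (κ * μ) ^ G.depth) * ‖C - C'‖ := by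
  refine (norm_generate_sub_le_norm_entries C C').trans ?_
  have h1 : G.volume C G.depth le_rfl * outWeights C - G.volume C' G.depth le_rfl * outWeights C'
      = G.volume C G.depth le_rfl * outWeights (C - C')
        + (G.volume C G.depth le_rfl - G.volume C' G.depth le_rfl) * outWeights C' := by
    have : outWeights (C - C') = outWeights C - outWeights C' := rfl
    rw [this, Matrix.mul_sub, Matrix.sub_mul]
    abel
  rw [h1]
  refine (norm_add_le (entries _) (entries _)).trans ((add_le_add (norm_entries_mul_le _ _)
    (norm_entries_mul_le _ _)).trans ?_)
  rw [norm_outWeights, norm_outWeights]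
  have h2 := norm_volume_le_pow hκ h hξ hC _ le_rfl
  have h3 := norm_volume_sub_le hκ h hξ hC hC' _ le_rfl
  have h4 := blockNorm_le (C - C') le_rfl
  have h5 := (blockNorm_le C' le_rfl).trans hC'
  have h6 := mul_le_mul h2 h4 (blockNorm_nonneg _ _) ((norm_nonneg _).trans h2)
  have h7 := mul_le_mul_of_nonneg_left h5
    (norm_nonneg (G.volume C G.depth le_rfl - G.volume C' G.depth le_rfl))
  linarith

/-- AM-GM: the squared block norms sum to `‖C‖ ^ 2`, so their geometric mean is at most `μ ^ 2 / (d
+ 1)`, and `d + 1 ≥ 2`. -/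
lemma prod_blockNorm_sq_le {μ : ℝ} (hd : 1 ≤ G.depth) {C : G.Params} (hC : ‖C‖ ≤ μ) :
    (∏ l ∈ Finset.range (G.depth + 1), G.blockNorm C l) ^ 2 ≤ (μ ^ 2 / 2) ^ (G.depth + 1) := by
  have hd' : (1 : ℝ) ≤ G.depth := by exact_mod_cast hd
  have hs : ∑ l ∈ Finset.range (G.depth + 1), (1 : ℝ) = G.depth + 1 := by simp
  have h := Real.geom_mean_le_arith_mean (Finset.range (G.depth + 1)) (fun _ => 1)
    (fun l => G.blockNorm C l ^ 2) (fun _ _ => zero_le_one) (by rw [hs]; positivity)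
    (fun _ _ => sq_nonneg _)
  simp only [Real.rpow_one, one_mul, sum_blockNorm_sq, hs] at h
  rw [← Finset.prod_pow]
  have hnonneg : 0 ≤ ∏ l ∈ Finset.range (G.depth + 1), G.blockNorm C l ^ 2 :=
    Finset.prod_nonneg fun _ _ => sq_nonneg _
  calc _ = ((∏ l ∈ Finset.range (G.depth + 1), G.blockNorm C l ^ 2)
        ^ ((G.depth : ℝ) + 1)⁻¹) ^ (G.depth + 1) := by
        rw [← Real.rpow_natCast, ← Real.rpow_mul hnonneg]
        push_cast
        rw [inv_mul_cancel₀ (by positivity), Real.rpow_one]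
    _ ≤ (‖C‖ ^ 2 / (G.depth + 1)) ^ (G.depth + 1) := by gcongr
    _ ≤ (μ ^ 2 / 2) ^ (G.depth + 1) := by
        gcongr
        linarith

end ConvGenerator

/-! ### The degenerate regime and the existence of a best approximation. -/

namespace ConvGenerator

open scoped Matrix.Norms.L2Operator in
lemma inputNorm_nonneg (G : ConvGenerator) : 0 ≤ G.inputNorm := norm_nonneg G.input

variable {G : ConvGenerator} {κ ξ μ δ : ℝ}

/-- If the sample-complexity logarithm is at most `log √2`, then the images of any two points of
the ball are within `2 δ` of each other. -/
lemma norm_generate_sub_le_of_ratio_le (hd : 1 ≤ G.depth) (hκ : 0 ≤ κ)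
    (h : ∀ i < G.depth, G.LayerNormLE i κ) (hξ : G.inputNorm ≤ ξ) (hμ : 0 < μ) (hδ : 0 < δ)
    (hR : G.depth * ξ * μ / δ ≤ √2) (hκμ : κ * μ ≤ √2)
    {C C' : G.Params} (hC : ‖C‖ ≤ μ) (hC' : ‖C'‖ ≤ μ) :
    ‖G.generate C - G.generate C'‖ ≤ 2 * δ := by
  have hξ0 : 0 ≤ ξ := G.inputNorm_nonneg.trans hξ
  have hd' : (1 : ℝ) ≤ G.depth := by exact_mod_cast hd
  -- The final weights vanish at the zero parameter, so a single product over all `d + 1` blocks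
  -- remains. Its AM-GM gain `2 ^ (d + 1)` (in squares) pays for `2 ^ d` from `κ * μ ≤ √2` and `2`
  -- from `ξ * μ ≤ √2 * δ`.
  have key : ∀ C : G.Params, ‖C‖ ≤ μ → ‖G.generate C - G.generate 0‖ ≤ δ := by
    intro C hC
    refine (norm_generate_sub_le_norm_entries C 0).trans ?_
    have h0 : outWeights (0 : G.Params) = 0 := rfl
    rw [h0, Matrix.mul_zero, sub_zero]
    refine (norm_entries_mul_le _ _).trans ?_
    rw [norm_outWeights]
    refine (mul_le_mul_of_nonneg_right (norm_volume_le hκ h hξ C _ le_rfl)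
      (blockNorm_nonneg _ _)).trans ?_
    rw [mul_assoc, ← Finset.prod_range_succ]
    have hprod := prod_blockNorm_sq_le hd hC
    have hnonneg : 0 ≤ ∏ l ∈ Finset.range (G.depth + 1), G.blockNorm C l :=
      Finset.prod_nonneg fun _ _ => blockNorm_nonneg _ _
    rw [← sq_le_sq₀ (by positivity) hδ.le, mul_pow]
    have h1 : (ξ * μ) ^ 2 ≤ 2 * δ ^ 2 := by
      have h2 : ξ * μ ≤ √2 * δ := by
        rw [div_le_iff₀ hδ] at hR
        have : 0 ≤ ξ * μ := by positivity
        nlinarith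
      calc (ξ * μ) ^ 2 ≤ (√2 * δ) ^ 2 := by gcongr
        _ = 2 * δ ^ 2 := by rw [mul_pow, Real.sq_sqrt (by norm_num)]
    have h3 : ((κ * μ) ^ 2) ^ G.depth ≤ 2 ^ G.depth := by
      gcongr
      calc (κ * μ) ^ 2 ≤ √2 ^ 2 := by gcongr
        _ = 2 := Real.sq_sqrt (by norm_num)
    calc (ξ * κ ^ G.depth) ^ 2 * (∏ l ∈ Finset.range (G.depth + 1), G.blockNorm C l) ^ 2
        ≤ (ξ * κ ^ G.depth) ^ 2 * (μ ^ 2 / 2) ^ (G.depth + 1) := by gcongr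
      _ = (ξ * μ) ^ 2 * ((κ * μ) ^ 2) ^ G.depth / 2 ^ (G.depth + 1) := by
        rw [div_pow, pow_succ (μ ^ 2), mul_pow κ μ, mul_pow (κ ^ 2), mul_pow ξ, mul_pow ξ,
          pow_right_comm κ]
        ring
      _ ≤ (2 * δ ^ 2) * 2 ^ G.depth / 2 ^ (G.depth + 1) := by gcongr
      _ = δ ^ 2 := by rw [pow_succ, div_eq_iff (by positivity)]; ring
  have h1 := key C hC
  have h2 := key C' hC'
  have h3 := norm_sub_le_norm_sub_add_norm_sub (G.generate C) (G.generate 0) (G.generate C')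
  rw [norm_sub_rev (G.generate 0)] at h3
  linarith

lemma mul_le_ratio (hμ : 0 < μ) (hδ : 0 < δ) (hκδ : 1 < κ * μ → κ * δ ≤ G.depth * ξ)
    (h1 : 1 < κ * μ) : κ * μ ≤ G.depth * ξ * μ / δ := by
  rw [le_div_iff₀ hδ]
  have := mul_le_mul_of_nonneg_right (hκδ h1) hμ.le
  linarith

/-- The best approximation by the generator over a ball is attained. -/
lemma exists_minimizer (hκ : 0 ≤ κ) (h : ∀ i < G.depth, G.LayerNormLE i κ)
    (hμ : 0 < μ) (x : G.Signal) :
    ∃ Cstar : G.Params, ‖Cstar‖ ≤ μ ∧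
      ∀ C : G.Params, ‖C‖ ≤ μ → ‖G.generate Cstar - x‖ ≤ ‖G.generate C - x‖ := by
  have hlip : LipschitzOnWith (Real.toNNReal ((G.depth + 1) * (G.inputNorm * (κ * μ) ^ G.depth)))
      G.generate (Metric.closedBall 0 μ) := by
    refine LipschitzOnWith.of_dist_le_mul fun C hC C' hC' => ?_
    rw [dist_eq_norm, dist_eq_norm, Real.coe_toNNReal']
    exact (norm_generate_sub_le hκ h le_rfl (mem_closedBall_zero_iff.1 hC)
      (mem_closedBall_zero_iff.1 hC')).trans
      (mul_le_mul_of_nonneg_right (le_max_left _ _) (norm_nonneg _))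
  obtain ⟨z, hz, hmin⟩ := (isCompact_closedBall (0 : G.Params) μ).exists_isMinOn
    ⟨0, Metric.mem_closedBall_self hμ.le⟩ (hlip.continuousOn.sub continuousOn_const).norm
  exact ⟨z, mem_closedBall_zero_iff.1 hz, fun C hC => hmin (mem_closedBall_zero_iff.2 hC)⟩

end ConvGenerator

/-! ### Net sizes in terms of the sample complexity, and deterministic recovery. -/

/-- The nets in the chaining argument are no larger than the sample complexity allows. -/
lemma net_card_le {R ξ μ δ b : ℝ} {d : ℕ} (hd : 1 ≤ d) (hξ : 0 < ξ) (hδ : 0 < δ)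
    (hRdef : R = d * ξ * μ / δ) (hR : √2 < R) (hb : 1 ≤ b) (hbR : b ≤ R) (N i : ℕ) :
    (1 + 2 * μ / (δ / (10 * ((d + 1) * (ξ * b ^ d))) / 2 ^ i)) ^ N
      ≤ Real.exp (13 * (i + 1) * (N * d * Real.log R)) := by
  have hd' : (1 : ℝ) ≤ d := by exact_mod_cast hd
  have hR2 : 2 ≤ R ^ 2 := by
    rw [← Real.sq_sqrt (show (0 : ℝ) ≤ 2 by norm_num)]
    gcongr
  have hR14 : 7 / 5 ≤ R := by
    have : 7 / 5 ≤ √2 := Real.le_sqrt_of_sq_le (by norm_num)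
    linarith
  have hR0 : 0 < R := by linarith
  have hR1 : 1 ≤ R := by linarith
  have hexp : Real.exp (13 * (i + 1) * (N * d * Real.log R)) = (R ^ (13 * d * (i + 1))) ^ N := by
    rw [← pow_mul, ← Real.exp_log (show 0 < R ^ (13 * d * (i + 1) * N) by positivity), Real.log_pow]
    congr 1
    push_cast
    ring
  have hμ : 0 < μ := by
    by_contra! hμ
    have : R ≤ 0 := by
      rw [hRdef]
      exact div_nonpos_of_nonpos_of_nonneg
        (mul_nonpos_of_nonneg_of_nonpos (by positivity) hμ) hδ.le
    linarith
  rw [hexp]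
  refine pow_le_pow_left₀ (by positivity) ?_ N
  have h1 : 2 * μ / (δ / (10 * ((d + 1) * (ξ * b ^ d))) / 2 ^ i)
      ≤ 40 * (2 ^ i * R ^ (d + 1)) := by
    calc 2 * μ / (δ / (10 * ((d + 1) * (ξ * b ^ d))) / 2 ^ i)
        = 20 * 2 ^ i * ((d + 1) * (ξ * μ / δ)) * b ^ d := by field_simp; ring
      _ ≤ 20 * 2 ^ i * (2 * R) * R ^ d := by
        have h1 : (d + 1) * (ξ * μ / δ) ≤ 2 * R := by
          have : 0 < ξ * μ / δ := by positivity
          calc (d + 1) * (ξ * μ / δ) ≤ (2 * d) * (ξ * μ / δ) :=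
                mul_le_mul_of_nonneg_right (by linarith) this.le
            _ = 2 * R := by rw [hRdef]; ring
        gcongr
      _ = 40 * (2 ^ i * R ^ (d + 1)) := by ring
  have h2 : (1 : ℝ) ≤ 2 ^ i * R ^ (d + 1) :=
    one_le_mul_of_one_le_of_one_le (one_le_pow₀ (by norm_num)) (one_le_pow₀ hR1)
  -- As `R > √2`, numerical constants and the factor `2 ^ i` can all be absorbed into powers of `R`.
  have h3 : 41 ≤ R ^ 11 := by
    calc (41 : ℝ) ≤ 2 ^ 5 * (7 / 5) := by norm_num
      _ ≤ (R ^ 2) ^ 5 * R := by gcongr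
      _ = R ^ 11 := by ring
  calc _ ≤ 41 * (2 ^ i * R ^ (d + 1)) := by linarith
    _ ≤ R ^ 11 * ((R ^ 2) ^ i * R ^ (d + 1)) := by gcongr
    _ = R ^ (11 + (2 * i + (d + 1))) := by rw [pow_add R 11, pow_add R (2 * i), pow_mul]
    _ ≤ R ^ (13 * d * (i + 1)) := by
      apply pow_le_pow_right₀ hR1
      have : i ≤ d * i := Nat.le_mul_of_pos_left i hd
      nlinarith

/-- The recovery guarantee for a linear map that satisfies the set-restricted eigenvalue condition
relative to the best approximation `u` of the signal `x`. -/
lemma recovery_of_restricted_eigenvalue {V W : Type*} [NormedAddCommGroup V] [NormedSpace ℝ V]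
    [NormedAddCommGroup W] [NormedSpace ℝ W] (T : V →ₗ[ℝ] W) {u v x : V} {y η : W} {ε δ : ℝ}
    (hy : y = T x + η) (hε : 0 ≤ ε) (hδ : 0 ≤ δ) (hu : ‖T (u - x)‖ ≤ 2 * ‖u - x‖)
    (hv : 4 / 5 * ‖v - u‖ ≤ ‖T (v - u)‖ + 13 / 10 * δ)
    (hopt : ‖y - T v‖ ≤ ‖y - T u‖ + ε) :
    ‖v - x‖ ≤ 6 * ‖u - x‖ + 3 * ‖η‖ + 2 * ε + 2 * δ := by
  have h1 : T (v - u) = (y - T u) - (y - T v) := by rw [map_sub]; abel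
  have h2 : y - T u = η - T (u - x) := by rw [hy, map_sub]; abel
  have h3 := norm_sub_le (y - T u) (y - T v)
  rw [← h1] at h3
  have h4 := norm_sub_le η (T (u - x))
  rw [← h2] at h4
  have h5 := norm_sub_le_norm_sub_add_norm_sub v u x
  have h6 := norm_nonneg η
  -- Here `‖T (v - u)‖ ≤ 2 * ‖η‖ + 4 * ‖u - x‖ + ε`. Multiplying by `5 / 4` gives `5 * ‖u - x‖`, and
  -- the last triangle inequality adds one more.
  linarith

end ConvNet

end

/-! ### Assembly of the theorem. -/

theorem theorem1 :
    ∃ K : ℝ, 0 < K ∧ ∃ c : ℝ, 0 < c ∧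
      ∀ (G : ConvNet.ConvGenerator) (κ ξ μ δ : ℝ) (m : ℕ) (x : G.Signal),
        1 ≤ G.depth →
        0 ≤ κ → (∀ i < G.depth, G.LayerNormLE i κ) →
        G.inputNorm ≤ ξ →
        0 < μ → 0 < δ → (1 < κ * μ → κ * δ ≤ G.depth * ξ) →
        K * (G.numParams * G.depth * Real.log (G.depth * ξ * μ / δ)) ≤ m →
        ∃ Cstar : G.Params, ‖Cstar‖ ≤ μ ∧
          (∀ C : G.Params, ‖C‖ ≤ μ → ‖G.generate Cstar - x‖ ≤ ‖G.generate C - x‖) ∧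
          ∃ E : Set (Fin m → G.OutIndex → ℝ), MeasurableSet E ∧
            ENNReal.ofReal (1 - Real.exp (-c * m)) ≤ ConvNet.gaussianMatrix m G.OutIndex E ∧
            ∀ A ∈ E, ∀ (η y : EuclideanSpace ℝ (Fin m)) (ε : ℝ) (Chat : G.Params),
              y = Matrix.toEuclideanLin (Matrix.of A) x + η →
              ‖Chat‖ ≤ μ →
              (∀ C : G.Params, ‖C‖ ≤ μ →
                ‖y - Matrix.toEuclideanLin (Matrix.of A) (G.generate Chat)‖
                  ≤ ‖y - Matrix.toEuclideanLin (Matrix.of A) (G.generate C)‖ + ε) →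
              ‖G.generate Chat - x‖
                ≤ 6 * ‖G.generate Cstar - x‖ + 3 * ‖η‖ + 2 * ε + 2 * δ := by
  refine ⟨2000, by norm_num, 1 / 200, by norm_num, ?_⟩
  intro G κ ξ μ δ m x hd hκ hlayer hξ hμ hδ hκδ hm
  obtain ⟨z, hz, hmin⟩ := ConvNet.ConvGenerator.exists_minimizer hκ hlayer hμ x
  refine ⟨z, hz, hmin, ?_⟩
  have hξ0 : 0 ≤ ξ := G.inputNorm_nonneg.trans hξ
  have hd' : (1 : ℝ) ≤ G.depth := by exact_mod_cast hd
  -- If the image has diameter at most `2 * δ`, no measurement is needed. Otherwise there is at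
  -- least one parameter and `R > √2`, which forces `m` to be large.
  by_cases hdiam : ∀ C C' : G.Params, ‖C‖ ≤ μ → ‖C'‖ ≤ μ →
      ‖G.generate C - G.generate C'‖ ≤ 2 * δ
  · refine ⟨Set.univ, MeasurableSet.univ, ?_, ?_⟩
    · rw [measure_univ]
      exact ENNReal.ofReal_le_one.2 (by linarith [Real.exp_pos (-(1 / 200) * (m : ℝ))])
    · intro A _ η y ε Chat _ hChat hopt
      have hε : 0 ≤ ε := by linarith [hopt Chat hChat]
      have h1 := hdiam Chat z hChat hz
      have h2 := norm_sub_le_norm_sub_add_norm_sub (G.generate Chat) (G.generate z) x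
      have h3 := norm_nonneg η
      have h4 := norm_nonneg (G.generate z - x)
      linarith
  have hN : 1 ≤ G.numParams := by
    rw [Nat.one_le_iff_ne_zero]
    intro hN
    have := Fintype.card_eq_zero_iff.1 hN
    apply hdiam
    intro C C' _ _
    rw [Subsingleton.elim C C', sub_self, norm_zero]
    positivity
  have hN' : (1 : ℝ) ≤ G.numParams := by exact_mod_cast hN
  set R : ℝ := G.depth * ξ * μ / δ with hRdef
  have hκR := ConvNet.ConvGenerator.mul_le_ratio hμ hδ hκδ
  have hsqrt : 1 ≤ √2 := Real.one_le_sqrt.2 (by norm_num)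
  have hR : √2 < R := by
    by_contra! hR
    refine hdiam fun C C' hC hC' => ConvNet.ConvGenerator.norm_generate_sub_le_of_ratio_le hd hκ
      hlayer hξ hμ hδ hR ?_ hC hC'
    rcases le_or_gt (κ * μ) 1 with h | h
    · exact h.trans hsqrt
    · exact (hκR h).trans hR
  have hξpos : 0 < ξ := by
    refine hξ0.lt_of_ne fun h => ?_
    rw [hRdef, ← h, mul_zero, zero_mul, zero_div] at hR
    linarith
  -- The maximum with `1` keeps the Lipschitz constant positive, even for `κ = 0`, so that it can be
  -- divided by.
  set b : ℝ := max (κ * μ) 1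
  have hbR : b ≤ R := by
    refine max_le ?_ (by linarith)
    rcases le_or_gt (κ * μ) 1 with h | h
    · linarith
    · exact hκR h
  have hm400 : 400 ≤ m := by
    have hlog : 1 / 4 ≤ Real.log R := by
      have h1 : Real.log √2 ≤ Real.log R := Real.log_le_log (by positivity) hR.le
      rw [Real.log_sqrt (by norm_num)] at h1
      linarith [Real.log_two_gt_d9]
    have h2 : 1 * 1 * (1 / 4) ≤ G.numParams * G.depth * Real.log R := by gcongr
    have : (400 : ℝ) ≤ m := by linarith
    exact_mod_cast this
  have hb1 : 1 ≤ b := le_max_right _ _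
  have hL : 0 < (G.depth + 1) * (ξ * b ^ G.depth) := by positivity
  obtain ⟨S, hS, hPS, hSA⟩ := ConvNet.exists_event_restricted_eigenvalue G.generate hμ.le hL.le
    -- Chosen so that `L * r = δ / 10`, making the chaining error `13 / 10 * δ`.
    (r := δ / (10 * ((G.depth + 1) * (ξ * b ^ G.depth)))) (by positivity)
    (fun C C' hC hC' => by
      refine (ConvNet.ConvGenerator.norm_generate_sub_le hκ hlayer hξ hC hC').trans ?_
      gcongr
      exact le_max_left _ _) hm hm400
    (fun i => by
      rw [finrank_euclideanSpace]
      exact ConvNet.net_card_le hd hξpos hδ hRdef hR hb1 hbR _ i) z x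
  refine ⟨S, hS, hPS, fun A hA η y ε Chat hy hChat hopt => ?_⟩
  obtain ⟨h1, h2⟩ := hSA A hA
  have h3 := h2 Chat hChat
  have h4 : 13 * ((G.depth + 1) * (ξ * b ^ G.depth) *
      (δ / (10 * ((G.depth + 1) * (ξ * b ^ G.depth))))) = 13 / 10 * δ := by
    field_simp
  rw [h4] at h3
  exact ConvNet.recovery_of_restricted_eigenvalue _ hy (by linarith [hopt Chat hChat]) hδ.le h1 h3
    (hopt z hz)
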